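/- Let $\vartheta>0$, $\sigma_G>0$, $y_0\in\mathbb R$ and $\theta>0$, and consider the Ornstein–Uhlenbeck type process driven by white Gaussian noise of intensity $\sigma_G$, $$dw=-\vartheta w\,dt+\sigma_G\,dq,\quad w(0)=0,\qquad \theta\,\frac{dy}{dt}=-y+w,\quad y(0)=y_0,$$ where $q$ is a standard Wiener process. Let $\phi$ be the standard normal density, $\mathcal Q(x)=\int_x^\infty\phi(u)\,du$, and $$\sigma_G'=\frac{\sigma_G}{\sqrt{2\vartheta}},\qquad p_{ss}(x)=\frac1{\sigma_G'}\,\phi\!\left(\frac{x}{\sigma_G'}\right),\qquad T_{ss}(\theta)=\frac{\ln(1/\theta)}{2\vartheta}$$ ($T_{ss}$ is the time from which $e^{-2\vartheta t}\le\theta$). **(1) Density.** There are $C>0$ and $\theta_0>0$, depending only on $\vartheta,\sigma_G,y_0$, such that for all $\theta\in(0,\theta_0)$ and all $t\ge T_{ss}(\theta)$ the random variable $y(t)$ has a continuous density $p$ with $|p(x)-p_{ss}(x)|\le C\theta$ for all $x\in\mathbb R$. **(2) Privacy.** Let $\epsilon>0$, $\delta\in(0,\tfrac12)$, $K_\delta=\mathcal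 Q^{-1}(\delta)$ and $$\kappa(\delta,\epsilon)=\frac{K_\delta+\sqrt{K_\delta^2+2\epsilon}}{2\epsilon}.$$ Let $F$ be a class of funnel boundaries $\psi:[0,\infty)\to(0,\infty)$, let $t_1,\dots,t_n\ge0$ be sampling times and $\delta\psi>0$. Call $\psi,\psi'\in F$ adjacent if $|\psi(t_i)-\psi'(t_i)|\le\delta\psi$ for all $i$. The data of $\psi$ is $d=\{(-\psi(t_i),\psi(t_i))\}_{i=1}^n$, the query is $Q(d)=(\psi(t_i))_{i=1}^n$, and its sensitivity is $\Delta Q=\sup\max_i|Q(d)_i-Q(d')_i|$, the supremum being over adjacent pairs in $F$. A mechanism $\mathcal M$ with real output is $(\epsilon,\delta)$-differentially private if $\mathbb P[\mathcal M(\psi)\in S]\le e^{\epsilon}\,\mathbb P[\mathcal M(\psi')\in S]+\delta$ for all adjacent $\psi,\psi'\in F$ and all Borel sets $S\subseteq\mathbb R$. Suppose that $$\sigma_G'\ \ge\ \Delta Q\,\kappa(\delta,\epsilon).$$ Then: (a) if $Y$ has the steady-state density $p_{ss}$, the mechanism $Q(d)_i+Y$ is $(\epsilon,\delta)$-differentially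 private for every $i$; (b) there is $\theta_1>0$, depending only on $\vartheta,\sigma_G,\epsilon,\delta$, such that for all $\theta\in(0,\theta_1)$ and every $y_0$ the mechanism $Q(d)_i+y(t_i)$ is $(\epsilon,\delta)$-differentially private for every $i$ with $t_i\ge T_{ss}(\theta)$. -/

import Mathlib

open MeasureTheory ProbabilityTheory
open scoped NNReal ENNReal

/-- The standard normal density `φ`. -/
noncomputable def stdNormalPdf (x : ℝ) : ℝ :=
  1 / √(2 * Real.pi) * Real.exp (-(1 / 2) * x ^ 2)

/-- The Gaussian tail integral `𝒬(x) = ∫ₓ^∞ φ`. -/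
noncomputable def gaussianTail (x : ℝ) : ℝ :=
  ∫ u in Set.Ioi x, stdNormalPdf u

/-- The inverse of the Gaussian tail integral (`gaussianTail` is a bijection of `ℝ` onto `(0, 1)`,
and only arguments in this interval are used). -/
noncomputable def gaussianTailInv : ℝ → ℝ :=
  Function.invFun gaussianTail

/-- `κ(δ, ε) = (K_δ + √(K_δ² + 2ε)) / (2ε)` with `K_δ = 𝒬⁻¹(δ)`. -/
noncomputable def kappa (δ ε : ℝ) : ℝ :=
  (gaussianTailInv δ + √(gaussianTailInv δ ^ 2 + 2 * ε)) / (2 * ε)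

/-- The Ornstein-Uhlenbeck type process driven by white Gaussian noise of intensity `σ`:
`dw = -ϑ w dt + σ dq` with `w(0) = 0`, and `θ dy/dt = -y + w` with `y(0) = y₀`.
Here `q` is a Wiener process. The noise in the first equation is additive, so both equations are
plain integral equations, which hold along almost every path at all times. -/
structure IsOUTypeProcess {Ω : Type*} [MeasurableSpace Ω] (P : Measure Ω) (θ ϑ σ y₀ : ℝ)
    (q w y : ℝ≥0 → Ω → ℝ) : Prop where
  wiener : IsBrownianReal q P
  aemeasurable_w : ∀ t, AEMeasurable (w t) P
  aemeasurable_y : ∀ t, AEMeasurable (y t) P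
  continuous_w : ∀ᵐ ω ∂P, Continuous fun t : ℝ≥0 => w t ω
  continuous_y : ∀ᵐ ω ∂P, Continuous fun t : ℝ≥0 => y t ω
  slow : ∀ᵐ ω ∂P, ∀ t : ℝ≥0,
    w t ω = -ϑ * (∫ s in (0 : ℝ)..t, w s.toNNReal ω) + σ * q t ω
  fast : ∀ᵐ ω ∂P, ∀ t : ℝ≥0,
    θ * (y t ω - y₀) = ∫ s in (0 : ℝ)..t, (-y s.toNNReal ω + w s.toNNReal ω)

/-- The steady-state standard deviation `σ' = σ / √(2ϑ)`. -/
noncomputable def steadyStateStd (ϑ σ : ℝ) : ℝ :=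
  σ / √(2 * ϑ)

/-- The steady-state density `p_ss(x) = φ(x / σ') / σ'`. -/
noncomputable def steadyStatePdf (ϑ σ x : ℝ) : ℝ :=
  1 / steadyStateStd ϑ σ * stdNormalPdf (x / steadyStateStd ϑ σ)

/-- The time `T_ss` from which the transient factor `e^{-2ϑt}` of the variance of the slow
variable is at most `θ`, that is, from which the process is in steady state up to `O(θ)`. -/
noncomputable def steadyStateTime (ϑ θ : ℝ) : ℝ :=
  Real.log (1 / θ) / (2 * ϑ)

/-- A funnel boundary trajectory: `0 < ψ(t) < ∞` for all `t ≥ 0`. -/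
def IsFunnelBoundary (ψ : ℝ≥0 → ℝ) : Prop :=
  ∀ t, 0 < ψ t

/-- The data of a funnel boundary at the sampling times: the pairs `(-ψ(tᵢ), ψ(tᵢ))`. -/
def funnelData {n : ℕ} (τ : Fin n → ℝ≥0) (ψ : ℝ≥0 → ℝ) : Fin n → ℝ × ℝ :=
  fun i => (-ψ (τ i), ψ (τ i))

/-- The query `Q(d) = ψ`, at the sampling times. -/
def funnelQuery {n : ℕ} (d : Fin n → ℝ × ℝ) : Fin n → ℝ :=
  fun i => (d i).2

/-- The adjacency relation: `|ψ(tᵢ) - ψ'(tᵢ)| ≤ δψ` at all sampling times. -/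
def FunnelAdj {n : ℕ} (τ : Fin n → ℝ≥0) (δψ : ℝ) (ψ ψ' : ℝ≥0 → ℝ) : Prop :=
  ∀ i, |ψ (τ i) - ψ' (τ i)| ≤ δψ

/-- The sensitivity `ΔQ` of the query on the class `F` of funnel boundaries: the largest magnitude
by which its output changes across adjacent members (the norm is the sup norm on `Fin n → ℝ`). -/
noncomputable def querySensitivity {n : ℕ} (τ : Fin n → ℝ≥0) (δψ : ℝ)
    (F : Set (ℝ≥0 → ℝ)) : ℝ :=
  sSup {r | ∃ ψ ∈ F, ∃ ψ' ∈ F, FunnelAdj τ δψ ψ ψ' ∧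
    r = ‖funnelQuery (funnelData τ ψ) - funnelQuery (funnelData τ ψ')‖}

/-- The mechanism `Q(d) + Y` at the `i`-th sampling time, with additive noise `Y`. -/
def funnelMechanism {Ω : Type*} {n : ℕ} (τ : Fin n → ℝ≥0) (i : Fin n) (Y : Ω → ℝ)
    (ψ : ℝ≥0 → ℝ) : Ω → ℝ :=
  fun ω => funnelQuery (funnelData τ ψ) i + Y ω

/-- The real-valued mechanism `M` is `(ε, δ)`-differentially private with respect to the
adjacency relation `adj` on the members of `F`. -/
def IsDifferentiallyPrivate {Ω D : Type*} [MeasurableSpace Ω] (P : Measure Ω) (F : Set D)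
    (adj : D → D → Prop) (M : D → Ω → ℝ) (ε δ : ℝ) : Prop :=
  ∀ d ∈ F, ∀ d' ∈ F, adj d d' → ∀ S : Set ℝ, MeasurableSet S →
    P.real {ω | M d ω ∈ S} ≤ Real.exp ε * P.real {ω | M d' ω ∈ S} + δ

/-! The noise is exactly Gaussian. Variation of constants gives y(T) = e^{-T/θ} y₀ + σ ∫₀ᵀ k(T-s)
dq(s) with k = `filterKernel`. As k(0) = 0 and q(0) = 0, integration by parts makes this a pathwise
integral of k' against q (`cascade_eq`), whose law is a limit of laws of sums of independent
increments (`map_neg_integral_deriv_mul_brownian`). The variance σ² ∫₀ᵀ k² has a closed form, within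
O(θ) of σ'² once e^{-2ϑT} ≤ θ, and the mean is then O(θ) too. Gaussian densities are Lipschitz in
mean and variance, uniformly in x, while the variance stays away from 0; this gives (1).

For (2), the worst event for two shifted Gaussians is a half-line (`gaussianReal_unit_shift_le`), so
privacy is governed by a difference of two tails. The calibration κ makes the first tail equal to δ;
the second is subtracted and positive, so ρκ still suffices for some ρ < 1
(`exists_lt_one_gaussianPrivacyProfile_le`). For small θ this slack absorbs the O(θ) deficit in the
variance. The mean shifts both outputs alike and plays no role, so the threshold is free of y₀. -/

/-! ### The Gaussian tail and its inverse. -/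

section GaussianTail

open Filter Topology

lemma gaussianReal_real_eq_setIntegral (m : ℝ) {v : ℝ≥0} (hv : v ≠ 0) (S : Set ℝ) :
    (gaussianReal m v).real S = ∫ x in S, gaussianPDFReal m v x := by
  rw [Measure.real, gaussianReal_apply_eq_integral m hv S, ENNReal.toReal_ofReal]
  exact integral_nonneg fun x => gaussianPDFReal_nonneg m v x

lemma stdNormalPdf_eq_gaussianPDFReal (x : ℝ) : stdNormalPdf x = gaussianPDFReal 0 1 x := by
  simp only [stdNormalPdf, gaussianPDFReal, NNReal.coe_one, mul_one, sub_zero, one_div]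
  congr 2
  ring

lemma gaussianTail_eq_gaussianReal (x : ℝ) :
    gaussianTail x = (gaussianReal 0 1).real (Set.Ioi x) := by
  rw [gaussianReal_real_eq_setIntegral 0 one_ne_zero]
  simp only [gaussianTail, stdNormalPdf_eq_gaussianPDFReal]

lemma gaussianTail_eq_one_sub_cdf (x : ℝ) : gaussianTail x = 1 - cdf (gaussianReal 0 1) x := by
  rw [gaussianTail_eq_gaussianReal, cdf_eq_real, ← Set.compl_Iic,
    probReal_compl_eq_one_sub measurableSet_Iic]

lemma gaussianTail_antitone : Antitone gaussianTail := fun x y hxy => by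
  simp only [gaussianTail_eq_one_sub_cdf]
  linarith [monotone_cdf (gaussianReal 0 1) hxy]

lemma continuous_gaussianTail : Continuous gaussianTail := by
  have h : gaussianTail = fun x => gaussianTail 0 - ∫ u in (0 : ℝ)..x, gaussianPDFReal 0 1 u := by
    funext x
    have := intervalIntegral.integral_Iic_sub_Iic
      (integrable_gaussianPDFReal 0 1).integrableOn
      (integrable_gaussianPDFReal 0 1).integrableOn (a := 0) (b := x)
    rw [← this, gaussianTail_eq_one_sub_cdf, gaussianTail_eq_one_sub_cdf, cdf_eq_real, cdf_eq_real,
      gaussianReal_real_eq_setIntegral 0 one_ne_zero, gaussianReal_real_eq_setIntegral 0 one_ne_zero]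
    ring
  rw [h]
  exact continuous_const.sub
    (intervalIntegral.continuous_primitive
      (fun a b => (integrable_gaussianPDFReal 0 1).intervalIntegrable) 0)

lemma gaussianTail_pos (x : ℝ) : 0 < gaussianTail x := by
  unfold gaussianTail
  simp only [stdNormalPdf_eq_gaussianPDFReal]
  rw [setIntegral_pos_iff_support_of_nonneg_ae
    (ae_of_all _ fun x => gaussianPDFReal_nonneg 0 1 x)
    (integrable_gaussianPDFReal 0 1).integrableOn]
  have : Function.support (gaussianPDFReal 0 1) = Set.univ :=
    Set.eq_univ_of_forall fun x => (gaussianPDFReal_pos 0 1 x one_ne_zero).ne'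
  rw [this, Set.univ_inter]
  simp

lemma gaussianTail_gaussianTailInv {δ : ℝ} (h0 : 0 < δ) (h1 : δ < 1) :
    gaussianTail (gaussianTailInv δ) = δ := by
  apply Function.invFun_eq
  have htop : Tendsto gaussianTail atTop (𝓝 0) := by
    have := (tendsto_cdf_atTop (gaussianReal 0 1)).const_sub 1
    simpa [← gaussianTail_eq_one_sub_cdf] using this
  have hbot : Tendsto gaussianTail atBot (𝓝 1) := by
    have := (tendsto_cdf_atBot (gaussianReal 0 1)).const_sub 1
    simpa [← gaussianTail_eq_one_sub_cdf] using this
  obtain ⟨a, ha⟩ := (htop.eventually_lt_const h0).exists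
  obtain ⟨b, hb⟩ := (hbot.eventually_const_lt h1).exists
  exact mem_range_of_exists_le_of_exists_ge continuous_gaussianTail ⟨a, ha.le⟩ ⟨b, hb.le⟩

end GaussianTail

/-! ### Privacy of the Gaussian mechanism and the calibration κ. -/

section GaussianMechanism

open Filter Topology

/-- The least `δ` for which the Gaussian mechanism with unit sensitivity and standard deviation `r`
is `(ε, δ)`-differentially private. -/
noncomputable def gaussianPrivacyProfile (ε r : ℝ) : ℝ :=
  gaussianTail (ε * r - 1 / (2 * r)) - Real.exp ε * gaussianTail (ε * r + 1 / (2 * r))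

lemma gaussianPDFReal_unit_shift (c x : ℝ) :
    gaussianPDFReal c 1 x = Real.exp (c * x - c ^ 2 / 2) * gaussianPDFReal 0 1 x := by
  simp only [gaussianPDFReal, NNReal.coe_one, mul_one]
  rw [mul_left_comm, ← Real.exp_add]
  congr 2
  ring

lemma gaussianReal_unit_Ioi (c x : ℝ) :
    (gaussianReal c 1).real (Set.Ioi x) = gaussianTail (x - c) := by
  have h := gaussianReal_map_add_const (μ := 0) (v := 1) c
  rw [zero_add] at h
  rw [← h, map_measureReal_apply (by fun_prop) measurableSet_Ioi, gaussianTail_eq_gaussianReal]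
  congr 1
  ext y
  simp [sub_lt_iff_lt_add]

/-- Neyman–Pearson: the integral of `k` over S is largest when S is the set where `k` is
nonnegative, a half-line because the likelihood ratio increases in x. -/
lemma gaussianReal_unit_shift_le {c : ℝ} (hc : 0 < c) (ε : ℝ) {S : Set ℝ} (hS : MeasurableSet S) :
    (gaussianReal c 1).real S ≤
      Real.exp ε * (gaussianReal 0 1).real S + gaussianPrivacyProfile ε c⁻¹ := by
  set k : ℝ → ℝ := fun x => gaussianPDFReal c 1 x - Real.exp ε * gaussianPDFReal 0 1 x with hk
  have hki : Integrable k :=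
    (integrable_gaussianPDFReal c 1).sub ((integrable_gaussianPDFReal 0 1).const_mul _)
  have hkS : ∀ A : Set ℝ, ∫ x in A, k x =
      (gaussianReal c 1).real A - Real.exp ε * (gaussianReal 0 1).real A := fun A => by
    rw [gaussianReal_real_eq_setIntegral c one_ne_zero,
      gaussianReal_real_eq_setIntegral 0 one_ne_zero, ← integral_const_mul]
    exact integral_sub (integrable_gaussianPDFReal c 1).integrableOn
      ((integrable_gaussianPDFReal 0 1).const_mul _).integrableOn
  -- The point where the likelihood ratio exp(c x - c²/2) equals e^ε.
  set x₀ : ℝ := ε / c + c / 2 with hx₀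
  have hkx : ∀ x, k x =
      (Real.exp (c * x - c ^ 2 / 2) - Real.exp ε) * gaussianPDFReal 0 1 x := fun x => by
    rw [hk]
    simp only
    rw [gaussianPDFReal_unit_shift]
    ring
  have hcx₀ : c * x₀ - c ^ 2 / 2 = ε := by rw [hx₀]; field_simp; ring
  have hpos : ∀ x, x₀ < x → 0 ≤ k x := fun x hx => by
    rw [hkx]
    refine mul_nonneg (sub_nonneg.2 (Real.exp_le_exp.2 ?_)) (gaussianPDFReal_nonneg _ _ _)
    nlinarith
  have hneg : ∀ x, x ≤ x₀ → k x ≤ 0 := fun x hx => by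
    rw [hkx]
    refine mul_nonpos_of_nonpos_of_nonneg (sub_nonpos.2 (Real.exp_le_exp.2 ?_))
      (gaussianPDFReal_nonneg _ _ _)
    nlinarith
  have hle : ∫ x in S, k x ≤ ∫ x in Set.Ioi x₀, k x := by
    rw [← integral_indicator hS, ← integral_indicator measurableSet_Ioi]
    refine integral_mono (hki.indicator hS) (hki.indicator measurableSet_Ioi) fun x => ?_
    rcases le_or_gt x x₀ with hx | hx
    · rw [Set.indicator_of_notMem (show x ∉ Set.Ioi x₀ from not_lt.2 hx)]
      exact Set.indicator_apply_le' (fun _ => hneg x hx) fun _ => le_rfl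
    · rw [Set.indicator_of_mem (show x ∈ Set.Ioi x₀ from hx)]
      exact Set.indicator_apply_le' (fun _ => le_rfl) fun _ => hpos x hx
  rw [hkS, hkS, gaussianReal_unit_Ioi, gaussianReal_unit_Ioi] at hle
  have e1 : x₀ - c = ε * c⁻¹ - 1 / (2 * c⁻¹) := by rw [hx₀]; field_simp; ring
  have e2 : x₀ - 0 = ε * c⁻¹ + 1 / (2 * c⁻¹) := by rw [hx₀]; field_simp; ring
  rw [e1, e2] at hle
  unfold gaussianPrivacyProfile
  linarith

/-- Reduction to unit variance by x ↦ b + e s x, where the sign e = ±1 of a - b reflects the line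
when a < b. -/
lemma gaussianReal_shift_le {a b s : ℝ} (hab : a ≠ b) (hs : 0 < s) (ε : ℝ) {v : ℝ≥0}
    (hv : (v : ℝ) = s ^ 2) {S : Set ℝ} (hS : MeasurableSet S) :
    (gaussianReal a v).real S ≤
      Real.exp ε * (gaussianReal b v).real S + gaussianPrivacyProfile ε (s / |a - b|) := by
  obtain ⟨e, he, hab'⟩ : ∃ e : ℝ, e ^ 2 = 1 ∧ e * |a - b| = a - b := by
    rcases le_total 0 (a - b) with h | h
    · exact ⟨1, by norm_num, by rw [abs_of_nonneg h, one_mul]⟩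
    · exact ⟨-1, by norm_num, by rw [abs_of_nonpos h]; ring⟩
  have hd : 0 < |a - b| := abs_pos.2 (sub_ne_zero.2 hab)
  have hmap : ∀ c : ℝ, (gaussianReal c 1).map (fun x => b + (e * s) * x) =
      gaussianReal (e * s * c + b) v := fun c => by
    have : (fun x : ℝ => b + (e * s) * x) = (b + ·) ∘ ((e * s) * ·) := rfl
    rw [this, ← Measure.map_map (by fun_prop) (by fun_prop), gaussianReal_map_const_mul,
      gaussianReal_map_const_add]
    congr 1
    ext
    rw [hv]
    simp [mul_pow, he]
  have hT : Measurable fun x : ℝ => b + (e * s) * x := by fun_prop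
  have ha := hmap (|a - b| / s)
  rw [show e * s * (|a - b| / s) + b = a by field_simp; linarith] at ha
  have hb := hmap 0
  rw [mul_zero, zero_add] at hb
  rw [← ha, ← hb, map_measureReal_apply hT hS, map_measureReal_apply hT hS]
  have := gaussianReal_unit_shift_le (div_pos hd hs) ε (hT hS)
  rwa [inv_div] at this

lemma kappa_pos {ε : ℝ} (δ : ℝ) (hε : 0 < ε) : 0 < kappa δ ε := by
  unfold kappa
  refine div_pos ?_ (by positivity)
  have h : √(gaussianTailInv δ ^ 2) < √(gaussianTailInv δ ^ 2 + 2 * ε) :=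
    Real.sqrt_lt_sqrt (sq_nonneg _) (by linarith)
  rw [Real.sqrt_sq_eq_abs] at h
  linarith [neg_abs_le (gaussianTailInv δ)]

/-- κ is the positive root of 2ε r² - 2K r - 1 = 0 with K = `gaussianTailInv δ`. -/
lemma mul_kappa_sub {ε : ℝ} (δ : ℝ) (hε : 0 < ε) :
    ε * kappa δ ε - 1 / (2 * kappa δ ε) = gaussianTailInv δ := by
  have hκ := kappa_pos δ hε
  have hsq : √(gaussianTailInv δ ^ 2 + 2 * ε) ^ 2 = gaussianTailInv δ ^ 2 + 2 * ε :=
    Real.sq_sqrt (by positivity)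
  have h2 : 2 * ε * kappa δ ε - gaussianTailInv δ = √(gaussianTailInv δ ^ 2 + 2 * ε) := by
    unfold kappa
    field_simp
    ring
  rw [← h2] at hsq
  have : 2 * ε * kappa δ ε ^ 2 - 2 * gaussianTailInv δ * kappa δ ε - 1 = 0 := by
    have : 2 * ε * (2 * ε * kappa δ ε ^ 2 - 2 * gaussianTailInv δ * kappa δ ε - 1) = 0 := by
      linarith
    rcases mul_eq_zero.1 this with h | h
    · linarith
    · exact h
  field_simp
  linarith

lemma gaussianPrivacyProfile_le {ε δ r : ℝ} (hε : 0 < ε) (h0 : 0 < δ) (h1 : δ < 1)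
    (hr : kappa δ ε ≤ r) : gaussianPrivacyProfile ε r ≤ δ := by
  have hκ := kappa_pos δ hε
  have h : gaussianTailInv δ ≤ ε * r - 1 / (2 * r) := by
    rw [← mul_kappa_sub δ hε]
    gcongr
  have h2 := gaussianTail_antitone h
  rw [gaussianTail_gaussianTailInv h0 h1] at h2
  have := mul_pos (Real.exp_pos ε) (gaussianTail_pos (ε * r + 1 / (2 * r)))
  unfold gaussianPrivacyProfile
  linarith

/-- The classical calibration `κ` of the Gaussian mechanism is not tight. -/
lemma exists_lt_one_gaussianPrivacyProfile_le {ε δ : ℝ} (hε : 0 < ε) (h0 : 0 < δ) (h1 : δ < 1) :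
    ∃ ρ : ℝ, 0 < ρ ∧ ρ < 1 ∧ ∀ r, ρ * kappa δ ε ≤ r → gaussianPrivacyProfile ε r ≤ δ := by
  have hκ := kappa_pos δ hε
  have hlt : gaussianPrivacyProfile ε (kappa δ ε) < δ := by
    unfold gaussianPrivacyProfile
    rw [mul_kappa_sub δ hε, gaussianTail_gaussianTailInv h0 h1]
    have := mul_pos (Real.exp_pos ε) (gaussianTail_pos (ε * kappa δ ε + 1 / (2 * kappa δ ε)))
    linarith
  have hcont : ContinuousAt (gaussianPrivacyProfile ε) (kappa δ ε) := by
    have hc := continuous_gaussianTail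
    have hne : 2 * kappa δ ε ≠ 0 := by positivity
    unfold gaussianPrivacyProfile
    have hd : ContinuousAt (fun r : ℝ => 1 / (2 * r)) (kappa δ ε) :=
      continuousAt_const.div (by fun_prop) hne
    have hm : ContinuousAt (fun r : ℝ => ε * r) (kappa δ ε) := by fun_prop
    exact (hc.continuousAt.comp (hm.sub hd)).sub
      (continuousAt_const.mul (hc.continuousAt.comp (hm.add hd)))
  obtain ⟨η, hη, hball⟩ := Metric.eventually_nhds_iff.1 (hcont.eventually_lt_const hlt)
  set κ := kappa δ ε with hκdef
  -- Any r in [ρκ, κ) is within η/2 of κ, inside the continuity ball; the maximum with 1/2 keeps ρ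
  -- positive.
  refine ⟨max (1 / 2) (1 - η / (2 * κ)), by positivity, max_lt (by norm_num) ?_, fun r hr => ?_⟩
  · have : 0 < η / (2 * κ) := by positivity
    linarith
  · rcases le_or_gt κ r with h | h
    · exact gaussianPrivacyProfile_le hε h0 h1 h
    · refine (hball ?_).le
      have h3 : (1 - η / (2 * κ)) * κ ≤ r :=
        (mul_le_mul_of_nonneg_right (le_max_right _ _) hκ.le).trans hr
      have h4 : (1 - η / (2 * κ)) * κ = κ - η / 2 := by field_simp
      rw [Real.dist_eq, abs_sub_comm, abs_of_pos (sub_pos.2 h)]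
      linarith

end GaussianMechanism

/-! ### Lipschitz dependence of Gaussian densities on mean and variance. -/

section DensityComparison

lemma hasDerivAt_stdNormalPdf (x : ℝ) : HasDerivAt stdNormalPdf (-x * stdNormalPdf x) x := by
  unfold stdNormalPdf
  have h : HasDerivAt (fun x : ℝ => -(1 / 2) * x ^ 2) (-(1 / 2) * (2 * x)) x := by
    simpa using (hasDerivAt_pow 2 x).const_mul (-(1 / 2) : ℝ)
  exact (h.exp.const_mul (1 / √(2 * Real.pi))).congr_deriv (by ring)

lemma stdNormalPdf_nonneg (x : ℝ) : 0 ≤ stdNormalPdf x := by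
  unfold stdNormalPdf; positivity

/-- One bound for both derivatives needed below: |x| and |1 - x²| are at most 1 + x². -/
lemma one_add_sq_mul_stdNormalPdf_le (x : ℝ) : (1 + x ^ 2) * stdNormalPdf x ≤ 2 := by
  have h1 : 1 / √(2 * Real.pi) ≤ 1 := by
    rw [div_le_one (by positivity)]
    exact Real.one_le_sqrt.2 (by linarith [Real.pi_gt_three])
  have h2 : (1 + x ^ 2) * Real.exp (-(1 / 2) * x ^ 2) ≤ 2 := by
    have h3 := Real.add_one_le_exp (1 / 2 * x ^ 2)
    have h4 : Real.exp (-(1 / 2) * x ^ 2) * Real.exp (1 / 2 * x ^ 2) = 1 := by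
      rw [← Real.exp_add, ← Real.exp_zero]; congr 1; ring
    have h5 := Real.exp_pos (-(1 / 2) * x ^ 2)
    nlinarith [sq_nonneg x]
  unfold stdNormalPdf
  calc (1 + x ^ 2) * (1 / √(2 * Real.pi) * Real.exp (-(1 / 2) * x ^ 2))
      = 1 / √(2 * Real.pi) * ((1 + x ^ 2) * Real.exp (-(1 / 2) * x ^ 2)) := by ring
    _ ≤ 1 * 2 := by gcongr
    _ = 2 := one_mul _

lemma abs_stdNormalPdf_sub_le (x y : ℝ) : |stdNormalPdf x - stdNormalPdf y| ≤ 2 * |x - y| := by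
  have := Convex.norm_image_sub_le_of_norm_hasDerivWithin_le (C := 2) (s := Set.univ)
    (fun z _ => (hasDerivAt_stdNormalPdf z).hasDerivWithinAt) (fun z _ => ?_) convex_univ
    (Set.mem_univ y) (Set.mem_univ x)
  · exact this
  · rw [norm_mul, norm_neg, Real.norm_eq_abs, Real.norm_of_nonneg (stdNormalPdf_nonneg z)]
    refine le_trans (mul_le_mul_of_nonneg_right ?_ (stdNormalPdf_nonneg z))
      (one_add_sq_mul_stdNormalPdf_le z)
    nlinarith [sq_abs z, sq_nonneg (|z| - 1), sq_nonneg z]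

/-- The derivative of c φ(c x) in c is (1 - (c x)²) φ(c x), bounded independently of x. -/
lemma abs_scaled_stdNormalPdf_sub_le (x a b : ℝ) :
    |a * stdNormalPdf (a * x) - b * stdNormalPdf (b * x)| ≤ 2 * |a - b| := by
  have hd : ∀ c : ℝ, HasDerivAt (fun c => c * stdNormalPdf (c * x))
      ((1 - (c * x) ^ 2) * stdNormalPdf (c * x)) c := fun c => by
    have h := (hasDerivAt_id c).mul
      ((hasDerivAt_stdNormalPdf (c * x)).comp c ((hasDerivAt_id c).mul_const x))
    exact h.congr_deriv (by simp only [id_eq, Function.comp_apply]; ring)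
  have := Convex.norm_image_sub_le_of_norm_hasDerivWithin_le (C := 2) (s := Set.univ)
    (fun z _ => (hd z).hasDerivWithinAt) (fun z _ => ?_) convex_univ
    (Set.mem_univ b) (Set.mem_univ a)
  · exact this
  · rw [norm_mul, Real.norm_eq_abs, Real.norm_of_nonneg (stdNormalPdf_nonneg _)]
    refine le_trans (mul_le_mul_of_nonneg_right ?_ (stdNormalPdf_nonneg _))
      (one_add_sq_mul_stdNormalPdf_le (z * x))
    rw [abs_le]
    constructor <;> nlinarith [sq_nonneg (z * x)]

lemma gaussianPDFReal_eq_scaled (m s x : ℝ) (hs : 0 < s) :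
    gaussianPDFReal m (s ^ 2).toNNReal x = s⁻¹ * stdNormalPdf (s⁻¹ * (x - m)) := by
  unfold gaussianPDFReal stdNormalPdf
  rw [Real.coe_toNNReal _ (sq_nonneg s), Real.sqrt_mul (by positivity), Real.sqrt_sq hs.le]
  rw [mul_inv, one_div, ← mul_assoc, mul_comm (√(2 * Real.pi))⁻¹ s⁻¹]
  congr 2
  field_simp

lemma abs_gaussianPDFReal_sub_le {m s s₀ : ℝ} (hs₀ : 0 < s₀) (hs : s₀ / 2 ≤ s) (x : ℝ) :
    |gaussianPDFReal m (s ^ 2).toNNReal x - gaussianPDFReal 0 (s₀ ^ 2).toNNReal x| ≤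
      8 / s₀ ^ 2 * |m| + 4 / s₀ ^ 3 * |s ^ 2 - s₀ ^ 2| := by
  have hs' : 0 < s := by linarith
  rw [gaussianPDFReal_eq_scaled m s x hs', gaussianPDFReal_eq_scaled 0 s₀ x hs₀, sub_zero]
  have hinv : s⁻¹ ≤ 2 / s₀ := by
    rw [inv_le_comm₀ hs' (by positivity), inv_div]; exact hs
  have h1 : |s⁻¹ * stdNormalPdf (s⁻¹ * (x - m)) - s⁻¹ * stdNormalPdf (s⁻¹ * x)| ≤
      8 / s₀ ^ 2 * |m| := by
    rw [← mul_sub, abs_mul, abs_of_pos (inv_pos.2 hs')]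
    have := abs_stdNormalPdf_sub_le (s⁻¹ * (x - m)) (s⁻¹ * x)
    rw [← mul_sub, abs_mul, abs_of_pos (inv_pos.2 hs'), sub_sub_cancel_left, abs_neg] at this
    calc s⁻¹ * |stdNormalPdf (s⁻¹ * (x - m)) - stdNormalPdf (s⁻¹ * x)|
        ≤ 2 / s₀ * (2 * (2 / s₀ * |m|)) := by
          refine mul_le_mul hinv (this.trans ?_) (abs_nonneg _) (by positivity)
          gcongr
      _ = 8 / s₀ ^ 2 * |m| := by field_simp; ring
  have h2 : |s⁻¹ * stdNormalPdf (s⁻¹ * x) - s₀⁻¹ * stdNormalPdf (s₀⁻¹ * x)| ≤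
      4 / s₀ ^ 3 * |s ^ 2 - s₀ ^ 2| := by
    refine (abs_scaled_stdNormalPdf_sub_le x s⁻¹ s₀⁻¹).trans ?_
    -- Expressed through the variances, which are what the filter computation controls.
    have e : s⁻¹ - s₀⁻¹ = (s⁻¹ * s₀⁻¹ * (s + s₀)⁻¹) * (s₀ ^ 2 - s ^ 2) := by
      field_simp; ring
    rw [e, abs_mul, abs_of_pos (by positivity), abs_sub_comm (s₀ ^ 2)]
    have h3 : (s + s₀)⁻¹ ≤ s₀⁻¹ := inv_anti₀ hs₀ (by linarith)
    calc 2 * (s⁻¹ * s₀⁻¹ * (s + s₀)⁻¹ * |s ^ 2 - s₀ ^ 2|)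
        ≤ 2 * (2 / s₀ * s₀⁻¹ * s₀⁻¹ * |s ^ 2 - s₀ ^ 2|) := by gcongr
      _ = 4 / s₀ ^ 3 * |s ^ 2 - s₀ ^ 2| := by field_simp; ring
  exact (abs_sub_le _ _ _).trans (add_le_add h1 h2)

lemma steadyStateStd_pos {ϑ σ : ℝ} (hϑ : 0 < ϑ) (hσ : 0 < σ) : 0 < steadyStateStd ϑ σ := by
  unfold steadyStateStd; positivity

lemma steadyStateStd_sq {ϑ : ℝ} (hϑ : 0 < ϑ) (σ : ℝ) :
    steadyStateStd ϑ σ ^ 2 = σ ^ 2 * (1 / (2 * ϑ)) := by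
  unfold steadyStateStd
  rw [div_pow, Real.sq_sqrt (by positivity)]
  ring

lemma steadyStatePdf_eq_gaussianPDFReal {ϑ σ : ℝ} (hϑ : 0 < ϑ) (hσ : 0 < σ) (x : ℝ) :
    steadyStatePdf ϑ σ x = gaussianPDFReal 0 (steadyStateStd ϑ σ ^ 2).toNNReal x := by
  rw [gaussianPDFReal_eq_scaled 0 _ x (steadyStateStd_pos hϑ hσ), sub_zero, steadyStatePdf,
    one_div, div_eq_inv_mul]

end DensityComparison

/-! ### The impulse response and its L² norm. -/

section FilterKernel

/-- The impulse response of the two cascaded first order filters with rates `ϑ` and `1 / θ`. -/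
noncomputable def filterKernel (θ ϑ u : ℝ) : ℝ :=
  (Real.exp (-ϑ * u) - Real.exp (-u / θ)) / (1 - ϑ * θ)

/-- The derivative of `filterKernel`. -/
noncomputable def filterKernelDeriv (θ ϑ u : ℝ) : ℝ :=
  (Real.exp (-u / θ) / θ - ϑ * Real.exp (-ϑ * u)) / (1 - ϑ * θ)

lemma filterKernel_zero (θ ϑ : ℝ) : filterKernel θ ϑ 0 = 0 := by
  simp [filterKernel]

lemma hasDerivAt_exp_neg_div (θ u : ℝ) :
    HasDerivAt (fun u => Real.exp (-u / θ)) (-(Real.exp (-u / θ) / θ)) u := by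
  exact ((hasDerivAt_neg u).div_const θ).exp.congr_deriv (by ring)

lemma hasDerivAt_exp_neg_mul (ϑ u : ℝ) :
    HasDerivAt (fun u => Real.exp (-ϑ * u)) (-ϑ * Real.exp (-ϑ * u)) u := by
  exact ((hasDerivAt_id u).const_mul (-ϑ)).exp.congr_deriv (by simp only [id_eq]; ring)

lemma hasDerivAt_filterKernel (θ ϑ u : ℝ) :
    HasDerivAt (filterKernel θ ϑ) (filterKernelDeriv θ ϑ u) u := by
  unfold filterKernel filterKernelDeriv
  exact (((hasDerivAt_exp_neg_mul ϑ u).sub (hasDerivAt_exp_neg_div θ u)).div_const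
    (1 - ϑ * θ)).congr_deriv (by ring)

lemma continuous_filterKernel (θ ϑ : ℝ) : Continuous (filterKernel θ ϑ) := by
  unfold filterKernel; fun_prop

lemma continuous_filterKernelDeriv (θ ϑ : ℝ) : Continuous (filterKernelDeriv θ ϑ) := by
  unfold filterKernelDeriv; fun_prop

lemma filterKernelDeriv_eq {θ ϑ : ℝ} (hθ : θ ≠ 0) (h : 1 - ϑ * θ ≠ 0) (u : ℝ) :
    filterKernelDeriv θ ϑ u = Real.exp (-u / θ) / θ - ϑ * filterKernel θ ϑ u := by
  unfold filterKernel filterKernelDeriv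
  rw [div_eq_iff h, sub_mul, mul_assoc ϑ, div_mul_cancel₀ _ h]
  field_simp
  ring

/-- In the resonant case ϑθ = 1 both sides are 0, since division by zero gives 0. -/
lemma integral_filterKernel_sq {θ ϑ : ℝ} (hθ : 0 < θ) (hϑ : 0 < ϑ) (T : ℝ) :
    ∫ u in (0 : ℝ)..T, filterKernel θ ϑ u ^ 2 =
      ((1 - Real.exp (-ϑ * T) ^ 2) / (2 * ϑ)
        - 2 * θ * (1 - Real.exp (-ϑ * T) * Real.exp (-T / θ)) / (1 + ϑ * θ)
        + θ * (1 - Real.exp (-T / θ) ^ 2) / 2) / (1 - ϑ * θ) ^ 2 := by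
  have hs : 1 + ϑ * θ ≠ 0 := by positivity
  have hd : ∀ u : ℝ, HasDerivAt (fun u : ℝ =>
      ((1 - Real.exp (-ϑ * u) ^ 2) / (2 * ϑ)
        - 2 * θ * (1 - Real.exp (-ϑ * u) * Real.exp (-u / θ)) / (1 + ϑ * θ)
        + θ * (1 - Real.exp (-u / θ) ^ 2) / 2) / (1 - ϑ * θ) ^ 2) (filterKernel θ ϑ u ^ 2) u :=
    fun u => by
    have h1 := hasDerivAt_exp_neg_mul ϑ u
    have h2 := hasDerivAt_exp_neg_div θ u
    refine HasDerivAt.congr_deriv ((((((h1.pow 2).const_sub 1).div_const (2 * ϑ)).sub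
      ((((h1.mul h2).const_sub 1).const_mul (2 * θ)).div_const (1 + ϑ * θ))).add
      ((((h2.pow 2).const_sub 1).const_mul θ).div_const 2)).div_const ((1 - ϑ * θ) ^ 2)) ?_
    unfold filterKernel
    rw [div_pow]
    congr 1
    field_simp
    ring
  rw [intervalIntegral.integral_eq_sub_of_hasDerivAt (fun u _ => hd u)
    (((continuous_filterKernel θ ϑ).pow 2).intervalIntegrable _ _)]
  simp

lemma abs_integral_filterKernel_sq_sub_le {θ ϑ T : ℝ} (hθ : 0 < θ) (hϑ : 0 < ϑ) (hT : 0 ≤ T)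
    (hϑθ : ϑ * θ ≤ 1 / 2) (hexp : Real.exp (-ϑ * T) ^ 2 ≤ θ) :
    |(∫ u in (0 : ℝ)..T, filterKernel θ ϑ u ^ 2) - 1 / (2 * ϑ)| ≤ (2 / ϑ + 14) * θ := by
  rw [integral_filterKernel_sq hθ hϑ]
  have hE2 : Real.exp (-T / θ) ≤ 1 :=
    Real.exp_le_one_iff.2 (div_nonpos_of_nonpos_of_nonneg (by linarith) hθ.le)
  have hE1 : Real.exp (-ϑ * T) ≤ 1 := Real.exp_le_one_iff.2 (by nlinarith)
  have hp1 := Real.exp_pos (-ϑ * T)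
  have hp2 := Real.exp_pos (-T / θ)
  generalize Real.exp (-ϑ * T) = a at *
  generalize Real.exp (-T / θ) = b at *
  have hab : a * b ≤ 1 := by nlinarith
  have hb2 : b ^ 2 ≤ 1 := by nlinarith
  have hp : 0 < ϑ * θ := by positivity
  have hq : (1 : ℝ) / 4 ≤ (1 - ϑ * θ) ^ 2 := by nlinarith
  have hq0 : 0 < (1 - ϑ * θ) ^ 2 := by linarith
  -- The last term comes from (1 - (1 - ϑθ)²) / (2ϑ) = θ (1 - ϑθ/2). The numerator is at most θ/(2ϑ)
  -- + 7θ/2 in absolute value, and the denominator is at least 1/4, whence 2/ϑ + 14.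
  have e : ((1 - a ^ 2) / (2 * ϑ) - 2 * θ * (1 - a * b) / (1 + ϑ * θ) + θ * (1 - b ^ 2) / 2) /
      (1 - ϑ * θ) ^ 2 - 1 / (2 * ϑ) =
      (-(a ^ 2 / (2 * ϑ)) - 2 * θ * (1 - a * b) / (1 + ϑ * θ) + θ * (1 - b ^ 2) / 2
        + θ * (1 - ϑ * θ / 2)) / (1 - ϑ * θ) ^ 2 := by
    rw [eq_div_iff hq0.ne', sub_mul, div_mul_cancel₀ _ hq0.ne']
    field_simp
    ring
  rw [e, abs_div, abs_of_pos hq0, div_le_iff₀ hq0]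
  have t1 : a ^ 2 / (2 * ϑ) ≤ θ / (2 * ϑ) := by gcongr
  have t1' : 0 ≤ a ^ 2 / (2 * ϑ) := by positivity
  have t2 : 2 * θ * (1 - a * b) / (1 + ϑ * θ) ≤ 2 * θ := by
    rw [div_le_iff₀ (by positivity)]
    have : 0 < a * b := by positivity
    nlinarith [mul_pos hθ this, mul_pos hθ hp]
  have t2' : 0 ≤ 2 * θ * (1 - a * b) / (1 + ϑ * θ) :=
    div_nonneg (mul_nonneg (by positivity) (by linarith)) (by positivity)
  have t3 : θ * (1 - b ^ 2) / 2 ≤ θ / 2 := by nlinarith [mul_pos hθ (pow_pos hp2 2)]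
  have t3' : 0 ≤ θ * (1 - b ^ 2) / 2 := by
    have := mul_nonneg hθ.le (sub_nonneg.2 hb2); linarith
  have t4 : θ * (1 - ϑ * θ / 2) ≤ θ := by nlinarith [mul_pos hθ hp]
  have t4' : 0 ≤ θ * (1 - ϑ * θ / 2) := mul_nonneg hθ.le (by linarith)
  have hr : θ / (2 * ϑ) + 7 / 2 * θ ≤ (2 / ϑ + 14) * θ * (1 - ϑ * θ) ^ 2 := by
    have : 0 ≤ (2 / ϑ + 14) * θ := by positivity
    calc θ / (2 * ϑ) + 7 / 2 * θ = (2 / ϑ + 14) * θ * (1 / 4) := by field_simp; ring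
      _ ≤ _ := mul_le_mul_of_nonneg_left hq this
  rw [abs_le]
  constructor <;> linarith

end FilterKernel

/-! ### Convergence of Riemann and Riemann–Stieltjes sums. -/

section RiemannSums

open Filter Topology

/-- Used twice: with right-end tags for the Stieltjes sums of a path, and with g = 1 and left-end
tags for the variances. -/
lemma tendsto_sum_integral_mul_tag {g b : ℝ → ℝ} (hg : Continuous g) (hb : Continuous b) {T : ℝ}
    (hT : 0 ≤ T) (c : ℕ → ℕ → ℝ)
    (hc : ∀ N k, T * k / N ≤ c N k ∧ c N k ≤ T * (k + 1 : ℕ) / N) :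
    Tendsto (fun N : ℕ => ∑ k ∈ Finset.range N,
      ∫ s in (T * k / N)..(T * (k + 1 : ℕ) / N), g s * b (c N k)) atTop
      (𝓝 (∫ s in (0 : ℝ)..T, g s * b s)) := by
  obtain ⟨M, hM⟩ := isCompact_Icc.exists_bound_of_continuousOn (s := Set.Icc 0 T) hg.continuousOn
  have hM0 : 0 ≤ M := (norm_nonneg _).trans (hM 0 ⟨le_rfl, hT⟩)
  have hunif := isCompact_Icc.uniformContinuousOn_of_continuous (s := Set.Icc 0 T) hb.continuousOn
  rw [Metric.uniformContinuousOn_iff] at hunif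
  rw [Metric.tendsto_atTop]
  intro ε hε
  have hpos : 0 < M * T + 1 := by positivity
  obtain ⟨η, hη, hη'⟩ := hunif (ε / (M * T + 1)) (by positivity)
  obtain ⟨N₀, hN₀⟩ := exists_nat_gt (T / η)
  refine ⟨N₀ + 1, fun N hN => ?_⟩
  have hN' : (0 : ℝ) < N := by exact_mod_cast (Nat.succ_pos N₀).trans_le hN
  have hmesh : T / N < η := by
    rw [div_lt_iff₀ hN', mul_comm]
    rw [div_lt_iff₀ hη] at hN₀
    refine hN₀.trans_le (mul_le_mul_of_nonneg_right ?_ hη.le)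
    exact_mod_cast (Nat.le_succ N₀).trans hN
  have hstep : ∀ k : ℕ, T * (k + 1 : ℕ) / N - T * k / N = T / N := fun k => by
    push_cast; ring
  have hTN : 0 ≤ T / N := by positivity
  have hgb : Continuous fun s => g s * b s := hg.mul hb
  have hsplit : ∫ s in (0 : ℝ)..T, g s * b s =
      ∑ k ∈ Finset.range N, ∫ s in (T * k / N)..(T * (k + 1 : ℕ) / N), g s * b s := by
    rw [intervalIntegral.sum_integral_adjacent_intervals (a := fun k : ℕ => T * k / N)
      (fun k _ => hgb.intervalIntegrable _ _)]
    simp [hN'.ne']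
  rw [hsplit, dist_eq_norm, ← Finset.sum_sub_distrib]
  have hterm : ∀ k ∈ Finset.range N,
      ‖(∫ s in (T * k / N)..(T * (k + 1 : ℕ) / N), g s * b (c N k)) -
        ∫ s in (T * k / N)..(T * (k + 1 : ℕ) / N), g s * b s‖ ≤
      M * (ε / (M * T + 1)) * (T / N) := fun k hk => by
    have hgc : Continuous fun s => g s * b (c N k) := hg.mul continuous_const
    rw [← intervalIntegral.integral_sub (hgc.intervalIntegrable _ _)
      (hgb.intervalIntegrable _ _)]
    have hle : T * k / N ≤ T * (k + 1 : ℕ) / N := by linarith [hstep k]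
    have h0 : 0 ≤ T * k / N := by positivity
    have h1 : T * (k + 1 : ℕ) / N ≤ T := by
      rw [div_le_iff₀ hN']
      refine mul_le_mul_of_nonneg_left ?_ hT
      exact_mod_cast Finset.mem_range.1 hk
    refine (intervalIntegral.norm_integral_le_of_norm_le_const
      (C := M * (ε / (M * T + 1))) fun s hs => ?_).trans_eq ?_
    · rw [Set.uIoc_of_le hle] at hs
      obtain ⟨hc1, hc2⟩ := hc N k
      rw [← mul_sub, norm_mul]
      refine mul_le_mul (hM s ⟨by linarith [hs.1], by linarith [hs.2]⟩) ?_ (norm_nonneg _) hM0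
      rw [← dist_eq_norm]
      refine (hη' _ ⟨by linarith, by linarith⟩ _ ⟨by linarith [hs.1], by linarith [hs.2]⟩ ?_).le
      rw [Real.dist_eq, abs_lt]
      constructor <;> linarith [hs.1, hs.2, hstep k]
    · rw [hstep k, abs_of_nonneg hTN]
  refine (norm_sum_le_of_le _ hterm).trans_lt ?_
  rw [Finset.sum_const, Finset.card_range, nsmul_eq_mul]
  have : (N : ℝ) * (M * (ε / (M * T + 1)) * (T / N)) = ε * (M * T / (M * T + 1)) := by
    field_simp
  rw [this]
  have h2 : M * T / (M * T + 1) < 1 := by rw [div_lt_one hpos]; linarith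
  nlinarith

/-- Summation by parts: Riemann–Stieltjes sums of a `C¹` integrand against a continuous path. -/
lemma tendsto_stieltjes_sum {f f' b : ℝ → ℝ} (hf : ∀ s, HasDerivAt f (f' s) s)
    (hf' : Continuous f') (hb : Continuous b) {T : ℝ} (hT : 0 ≤ T) (hfT : f T = 0) (hb0 : b 0 = 0) :
    Tendsto (fun N : ℕ => ∑ k ∈ Finset.range N,
      f (T * k / N) * (b (T * (k + 1 : ℕ) / N) - b (T * k / N))) atTop
      (𝓝 (-∫ s in (0 : ℝ)..T, f' s * b s)) := by
  have hc : ∀ N k : ℕ, T * k / N ≤ T * (k + 1 : ℕ) / N := fun N k => by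
    gcongr; exact Nat.le_succ k
  refine (tendsto_sum_integral_mul_tag hf' hb hT (fun N k => T * (k + 1 : ℕ) / N)
    (fun N k => ⟨hc N k, le_rfl⟩)).neg.congr' ?_
  filter_upwards [eventually_gt_atTop 0] with N hN
  have hN' : (N : ℝ) ≠ 0 := by exact_mod_cast hN.ne'
  -- The products f b telescope to 0, which moves the increments from b to f and leaves b at the
  -- right endpoint.
  have htel := Finset.sum_range_sub (fun k : ℕ => f (T * k / N) * b (T * k / N)) N
  simp only [mul_div_cancel_right₀ T hN', hfT, Nat.cast_zero, mul_zero, zero_div, hb0, zero_mul,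
    sub_zero] at htel
  rw [← Finset.sum_neg_distrib, ← sub_eq_zero, ← Finset.sum_sub_distrib, ← neg_eq_zero,
    ← Finset.sum_neg_distrib, ← htel]
  refine Finset.sum_congr rfl fun k _ => ?_
  rw [intervalIntegral.integral_mul_const,
    intervalIntegral.integral_eq_sub_of_hasDerivAt (fun s _ => hf s) (hf'.intervalIntegrable _ _)]
  ring

end RiemannSums

/-! ### The law of a Wiener integral. -/

section WienerIntegral

open Filter Topology

variable {Ω : Type*} [MeasurableSpace Ω] {P : Measure Ω}

/-- Characteristic functions pass to the limit by dominated convergence; a zero limit variance is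
allowed. -/
lemma map_eq_gaussianReal_of_tendsto {X : ℕ → Ω → ℝ} {Y : Ω → ℝ} [IsProbabilityMeasure P]
    {v : ℕ → ℝ≥0} {v' : ℝ≥0} (hX : ∀ n, AEMeasurable (X n) P)
    (hlaw : ∀ n, P.map (X n) = gaussianReal 0 (v n)) (hv : Tendsto v atTop (𝓝 v'))
    (hlim : ∀ᵐ ω ∂P, Tendsto (fun n => X n ω) atTop (𝓝 (Y ω))) :
    P.map Y = gaussianReal 0 v' := by
  have hY : AEMeasurable Y P := aemeasurable_of_tendsto_metrizable_ae _ hX hlim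
  have : IsProbabilityMeasure (P.map Y) := Measure.isProbabilityMeasure_map hY
  refine Measure.ext_of_charFun (funext fun ξ => ?_)
  have hmap : ∀ Z : Ω → ℝ, AEMeasurable Z P →
      charFun (P.map Z) ξ = ∫ ω, Complex.exp (ξ * Z ω * Complex.I) ∂P := fun Z hZ => by
    rw [charFun_apply_real, integral_map hZ (by fun_prop)]
  have h1 : Tendsto (fun n => charFun (P.map (X n)) ξ) atTop (𝓝 (charFun (P.map Y) ξ)) := by
    simp only [hmap _ hY, fun n => hmap _ (hX n)]
    refine tendsto_integral_of_dominated_convergence (fun _ => 1) (fun n => ?_)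
      (integrable_const _) (fun n => ae_of_all _ fun ω => ?_) ?_
    · have : Continuous fun x : ℝ => Complex.exp (ξ * x * Complex.I) := by fun_prop
      exact (this.measurable.comp_aemeasurable (hX n)).aestronglyMeasurable
    · rw [← Complex.ofReal_mul, Complex.norm_exp_ofReal_mul_I]
    · filter_upwards [hlim] with ω hω
      have : Continuous fun x : ℝ => Complex.exp (ξ * x * Complex.I) := by fun_prop
      exact (this.tendsto _).comp hω
  have h2 : Tendsto (fun n => charFun (P.map (X n)) ξ) atTop
      (𝓝 (charFun (gaussianReal 0 v') ξ)) := by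
    simp only [hlaw, charFun_gaussianReal]
    have hc : Continuous fun u : ℝ≥0 =>
        Complex.exp (ξ * (0 : ℝ) * Complex.I - (u : ℝ) * (ξ : ℂ) ^ 2 / 2) := by fun_prop
    exact (hc.tendsto v').comp hv
  exact tendsto_nhds_unique h1 h2

lemma map_sum_increments_eq_gaussianReal {B : ℝ≥0 → Ω → ℝ} (hB : IsPreBrownianReal B P)
    {τ : ℕ → ℝ≥0} (hτ : Monotone τ) (a : ℕ → ℝ) (N : ℕ) :
    P.map (fun ω => ∑ k ∈ Finset.range N, a k * (B (τ (k + 1)) ω - B (τ k) ω)) =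
      gaussianReal 0 (∑ k ∈ Finset.range N, a k ^ 2 * ((τ (k + 1) : ℝ) - τ k)).toNNReal := by
  have hP : IsProbabilityMeasure P := hB.isGaussianProcess.isProbabilityMeasure
  have hmeas : ∀ k, AEMeasurable (fun ω => a k * (B (τ (k + 1)) ω - B (τ k) ω)) P := fun k =>
    ((hB.aemeasurable _).sub (hB.aemeasurable _)).const_mul _
  have hind : iIndepFun (fun k ω => a k * (B (τ (k + 1)) ω - B (τ k) ω)) P :=
    (hB.hasIndepIncrements.nat hτ).comp (fun k x => a k * x) fun k => by fun_prop
  have hind' : iIndepFun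
      ((Finset.range N).restrict fun k ω => a k * (B (τ (k + 1)) ω - B (τ k) ω)) P :=
    iIndepFun.precomp (g := ((↑) : Finset.range N → ℕ)) Subtype.val_injective hind
  have hsum : AEMeasurable
      (fun ω => ∑ k ∈ Finset.range N, a k * (B (τ (k + 1)) ω - B (τ k) ω)) P :=
    Finset.aemeasurable_fun_sum _ fun k _ => hmeas k
  have : IsProbabilityMeasure
      (P.map fun ω => ∑ k ∈ Finset.range N, a k * (B (τ (k + 1)) ω - B (τ k) ω)) :=
    Measure.isProbabilityMeasure_map hsum
  refine Measure.ext_of_charFun (funext fun ξ => ?_)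
  have hterm : ∀ k, charFun (P.map fun ω => a k * (B (τ (k + 1)) ω - B (τ k) ω)) ξ =
      Complex.exp (-((a k ^ 2 * ((τ (k + 1) : ℝ) - τ k) : ℝ) * (ξ : ℂ) ^ 2 / 2)) := fun k => by
    have h := gaussianReal_const_mul (hB.hasLaw_sub (τ (k + 1)) (τ k)) (a k)
    have h' := h.map_eq
    simp only [Pi.sub_apply] at h'
    rw [h', charFun_gaussianReal]
    have hd : ((nndist (τ (k + 1)).1 (τ k).1 : ℝ≥0) : ℝ) = (τ (k + 1) : ℝ) - τ k := by
      rw [coe_nndist, Real.dist_eq, abs_of_nonneg]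
      · rfl
      · exact sub_nonneg.2 (NNReal.coe_le_coe.2 (hτ (Nat.le_succ k)))
    rw [NNReal.coe_mul, hd]
    simp
  rw [iIndepFun.charFun_map_fun_finsetSum_eq_prod (fun k _ => hmeas k) hind', Finset.prod_apply,
    Finset.prod_congr rfl fun k _ => hterm k,
    ← Complex.exp_sum, charFun_gaussianReal, Real.coe_toNNReal]
  · congr 1
    push_cast
    rw [mul_zero, zero_mul, zero_sub, Finset.sum_neg_distrib, Finset.sum_mul, Finset.sum_div]
  · exact Finset.sum_nonneg fun k _ => mul_nonneg (sq_nonneg _)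
      (sub_nonneg.2 (NNReal.coe_le_coe.2 (hτ (Nat.le_succ k))))

/-- The Wiener integral `∫₀ᵀ f dB` of a `C¹` function vanishing at `T`, written as
`-∫₀ᵀ f' B ds`, is centred Gaussian with variance `∫₀ᵀ f²`. -/
lemma map_neg_integral_deriv_mul_brownian {B : ℝ≥0 → Ω → ℝ} (hB : IsBrownianReal B P)
    {f f' : ℝ → ℝ} (hf : ∀ s, HasDerivAt f (f' s) s) (hf' : Continuous f') (T : ℝ≥0)
    (hfT : f T = 0) :
    P.map (fun ω => -∫ s in (0 : ℝ)..T, f' s * B s.toNNReal ω) =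
      gaussianReal 0 (∫ s in (0 : ℝ)..T, f s ^ 2).toNNReal := by
  have hpre : IsPreBrownianReal B P := hB.toIsPreBrownianReal
  have hP : IsProbabilityMeasure P := hpre.isGaussianProcess.isProbabilityMeasure
  have hfc : Continuous f := continuous_iff_continuousAt.2 fun s => (hf s).continuousAt
  set τ : ℕ → ℕ → ℝ≥0 := fun N k => T * k / N with hτdef
  have hτc : ∀ N k, (τ N k : ℝ) = T * k / N := fun N k => by simp [hτdef]
  have hτ : ∀ N, Monotone (τ N) := fun N k l hkl => by
    simp only [hτdef]; gcongr
  refine map_eq_gaussianReal_of_tendsto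
    (X := fun N ω => ∑ k ∈ Finset.range N,
      f (τ N k) * (B (τ N (k + 1)) ω - B (τ N k) ω))
    (v := fun N => (∑ k ∈ Finset.range N,
      f (τ N k) ^ 2 * ((τ N (k + 1) : ℝ) - τ N k)).toNNReal) (fun N => ?_)
    (fun N => map_sum_increments_eq_gaussianReal hpre (hτ N) (fun k => f (τ N k)) N) ?_ ?_
  · exact Finset.aemeasurable_fun_sum _ fun k _ =>
      ((hpre.aemeasurable _).sub (hpre.aemeasurable _)).const_mul _
  · refine (continuous_real_toNNReal.tendsto _).comp ?_
    have hf2 : Continuous fun s => f s ^ 2 := hfc.pow 2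
    have h := tendsto_sum_integral_mul_tag (g := fun _ => 1) continuous_const hf2
      T.coe_nonneg (fun N k => T * k / N)
      (fun N k => ⟨le_rfl, by gcongr; exact Nat.le_succ k⟩)
    simp only [one_mul] at h
    refine h.congr fun N => Finset.sum_congr rfl fun k _ => ?_
    rw [intervalIntegral.integral_const, hτc, hτc, smul_eq_mul, mul_comm]
  · filter_upwards [hB.cont, hpre.eval_zero_ae_eq_zero] with ω hω h0
    have hb : Continuous fun s : ℝ => B s.toNNReal ω := hω.comp continuous_real_toNNReal
    have h := tendsto_stieltjes_sum hf hf' hb T.coe_nonneg hfT (by simpa using h0)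
    refine h.congr fun N => Finset.sum_congr rfl fun k _ => ?_
    rw [← hτc, ← hτc, Real.toNNReal_coe, Real.toNNReal_coe]

end WienerIntegral

/-! ### The exact Gaussian law of the fast variable. -/

section CascadeLaw

open Filter Topology

/-- Variation of constants for the cascade `w = -ϑ ∫ w + σ q`, `θ (y - y₀) = ∫ (-y + w)`. -/
lemma cascade_eq {θ ϑ σ y₀ : ℝ} (hθ : θ ≠ 0) (h1 : 1 - ϑ * θ ≠ 0) {q w y : ℝ≥0 → ℝ}
    (hq : Continuous q) (hw : Continuous w) (hy : Continuous y)
    (hslow : ∀ t : ℝ≥0, w t = -ϑ * (∫ s in (0 : ℝ)..t, w s.toNNReal) + σ * q t)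
    (hfast : ∀ t : ℝ≥0, θ * (y t - y₀) = ∫ s in (0 : ℝ)..t, (-y s.toNNReal + w s.toNNReal))
    (T : ℝ≥0) :
    y T = Real.exp (-T / θ) * y₀ +
      σ * ∫ s in (0 : ℝ)..T, filterKernelDeriv θ ϑ (T - s) * q s.toNNReal := by
  have hw' : Continuous fun s : ℝ => w s.toNNReal := hw.comp continuous_real_toNNReal
  have hy' : Continuous fun s : ℝ => y s.toNNReal := hy.comp continuous_real_toNNReal
  have hq' : Continuous fun s : ℝ => q s.toNNReal := hq.comp continuous_real_toNNReal
  have hW : ∀ s : ℝ, HasDerivAt (fun t : ℝ => ∫ r in (0 : ℝ)..t, w r.toNNReal) (w s.toNNReal) s :=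
    fun s => hw'.integral_hasStrictDerivAt 0 s |>.hasDerivAt
  have hY : ∀ s : ℝ, HasDerivAt (fun t : ℝ => ∫ r in (0 : ℝ)..t, (-y r.toNNReal + w r.toNNReal))
      (-y s.toNNReal + w s.toNNReal) s :=
    fun s => (hy'.neg.add hw').integral_hasStrictDerivAt 0 s |>.hasDerivAt
  set W : ℝ → ℝ := fun t => ∫ r in (0 : ℝ)..t, w r.toNNReal with hWdef
  set Y : ℝ → ℝ := fun t => ∫ r in (0 : ℝ)..t, (-y r.toNNReal + w r.toNNReal) with hYdef
  -- This function equals y(T) at s = T and e^{-T/θ} y₀ at s = 0. It uses the primitives `W` and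
  -- `Y`, since w itself need not be differentiable.
  have hΦ : ∀ s ∈ Set.uIcc (0 : ℝ) T, HasDerivAt
      (fun s : ℝ => Real.exp (-(T - s) / θ) * (y₀ + Y s / θ) - ϑ * filterKernel θ ϑ (T - s) * W s)
      (σ * (filterKernelDeriv θ ϑ (T - s) * q s.toNNReal)) s := fun s hs => by
    rw [Set.uIcc_of_le T.coe_nonneg] at hs
    have hTs : HasDerivAt (fun s : ℝ => (T : ℝ) - s) (-1) s := (hasDerivAt_id s).const_sub _
    have hE := (hasDerivAt_exp_neg_div θ (T - s)).comp s hTs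
    have hK := (hasDerivAt_filterKernel θ ϑ (T - s)).comp s hTs
    refine ((hE.mul (((hY s).div_const θ).const_add y₀)).sub
      ((hK.const_mul ϑ).mul (hW s))).congr_deriv ?_
    have es := hslow s.toNNReal
    have ef := hfast s.toNNReal
    rw [Real.coe_toNNReal s hs.1] at es ef
    change _ = -ϑ * W s + _ at es
    change _ = Y s at ef
    simp only [Function.comp_apply]
    rw [← ef, mul_div_cancel_left₀ _ hθ]
    have eσ : σ * (filterKernelDeriv θ ϑ (T - s) * q s.toNNReal) =
        filterKernelDeriv θ ϑ (T - s) * (w s.toNNReal + ϑ * W s) := by rw [es]; ring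
    rw [eσ, filterKernelDeriv_eq hθ h1]
    ring
  have hint := intervalIntegral.integral_eq_sub_of_hasDerivAt hΦ
    ((continuous_const.mul (((continuous_filterKernelDeriv θ ϑ).comp
      (continuous_const.sub continuous_id)).mul hq')).intervalIntegrable _ _)
  rw [intervalIntegral.integral_const_mul] at hint
  rw [hint]
  have hT := hfast T
  change _ = Y T at hT
  have hW0 : W 0 = 0 := by simp [hWdef]
  have hY0 : Y 0 = 0 := by simp [hYdef]
  rw [← hT, hW0, hY0, sub_self, filterKernel_zero, mul_div_cancel_left₀ _ hθ]
  simp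

lemma IsOUTypeProcess.map_eq_gaussianReal {Ω : Type*} [MeasurableSpace Ω] {P : Measure Ω}
    {θ ϑ σ y₀ : ℝ} {q w y : ℝ≥0 → Ω → ℝ} (h : IsOUTypeProcess P θ ϑ σ y₀ q w y)
    (hθ : θ ≠ 0) (h1 : 1 - ϑ * θ ≠ 0) (T : ℝ≥0) :
    P.map (y T) = gaussianReal (Real.exp (-T / θ) * y₀)
      (σ ^ 2 * ∫ u in (0 : ℝ)..T, filterKernel θ ϑ u ^ 2).toNNReal := by
  have hpath : y T =ᵐ[P] fun ω => Real.exp (-T / θ) * y₀ +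
      σ * -∫ s in (0 : ℝ)..T, -filterKernelDeriv θ ϑ (T - s) * q s.toNNReal ω := by
    filter_upwards [h.wiener.cont, h.continuous_w, h.continuous_y, h.slow, h.fast]
      with ω hq hw hy hs hf
    rw [cascade_eq hθ h1 hq hw hy hs hf T]
    simp only [neg_mul, intervalIntegral.integral_neg, neg_neg]
  have hI := map_neg_integral_deriv_mul_brownian h.wiener
    (f := fun s => filterKernel θ ϑ (T - s)) (f' := fun s => -filterKernelDeriv θ ϑ (T - s))
    (fun s => by
      have hTs : HasDerivAt (fun s : ℝ => (T : ℝ) - s) (-1) s := (hasDerivAt_id s).const_sub _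
      exact ((hasDerivAt_filterKernel θ ϑ (T - s)).comp s hTs).congr_deriv (by ring))
    ((continuous_filterKernelDeriv θ ϑ).comp (continuous_const.sub continuous_id)).neg T
    (by simp [filterKernel_zero])
  have hmeas : AEMeasurable (fun ω =>
      -∫ s in (0 : ℝ)..T, -filterKernelDeriv θ ϑ (T - s) * q s.toNNReal ω) P := by
    -- The pushforward along a map that is not a.e. measurable is 0, so a Gaussian law forces
    -- measurability.
    refine AEMeasurable.of_map_ne_zero ?_
    rw [hI]
    exact IsProbabilityMeasure.ne_zero _
  have hlaw : HasLaw (fun ω =>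
      -∫ s in (0 : ℝ)..T, -filterKernelDeriv θ ϑ (T - s) * q s.toNNReal ω) _ P := ⟨hmeas, hI⟩
  rw [Measure.map_congr hpath,
    (gaussianReal_const_add (gaussianReal_const_mul hlaw σ) (Real.exp (-T / θ) * y₀)).map_eq]
  have hnn : 0 ≤ ∫ u in (0 : ℝ)..T, filterKernel θ ϑ u ^ 2 :=
    intervalIntegral.integral_nonneg T.coe_nonneg fun u _ => sq_nonneg _
  congr 1
  · ring
  · ext
    rw [intervalIntegral.integral_comp_sub_left (fun u => filterKernel θ ϑ u ^ 2)]
    rw [Real.coe_toNNReal _ (by positivity)]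
    simp [Real.coe_toNNReal _ hnn]

end CascadeLaw

/-! ### From Gaussian noise to privacy of the funnel mechanism. -/

section FunnelPrivacy

lemma abs_sub_le_querySensitivity {n : ℕ} {τ : Fin n → ℝ≥0} {δψ : ℝ} (hδψ : 0 ≤ δψ)
    {F : Set (ℝ≥0 → ℝ)} {ψ ψ' : ℝ≥0 → ℝ} (hψ : ψ ∈ F) (hψ' : ψ' ∈ F)
    (hadj : FunnelAdj τ δψ ψ ψ') (i : Fin n) :
    |ψ (τ i) - ψ' (τ i)| ≤ querySensitivity τ δψ F := by
  -- Without boundedness `sSup` would take its default value 0.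
  have hbdd : BddAbove {r | ∃ ψ ∈ F, ∃ ψ' ∈ F, FunnelAdj τ δψ ψ ψ' ∧
      r = ‖funnelQuery (funnelData τ ψ) - funnelQuery (funnelData τ ψ')‖} := by
    refine ⟨δψ, ?_⟩
    rintro _ ⟨χ, -, χ', -, h, rfl⟩
    exact (pi_norm_le_iff_of_nonneg hδψ).2 h
  exact (norm_le_pi_norm (funnelQuery (funnelData τ ψ) - funnelQuery (funnelData τ ψ')) i).trans
    (le_csSup hbdd ⟨ψ, hψ, ψ', hψ', hadj, rfl⟩)

lemma isDifferentiallyPrivate_funnelMechanism {Ω : Type*} [MeasurableSpace Ω] {P : Measure Ω}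
    {Y : Ω → ℝ} {m s : ℝ} (hs : 0 < s) (hY : P.map Y = gaussianReal m (s ^ 2).toNNReal)
    {ε δ ρ : ℝ} (hε : 0 < ε) (hδ : 0 < δ) (hρ : 0 ≤ ρ)
    (hprofile : ∀ r, ρ * kappa δ ε ≤ r → gaussianPrivacyProfile ε r ≤ δ)
    {n : ℕ} {τ : Fin n → ℝ≥0} {F : Set (ℝ≥0 → ℝ)} {δψ : ℝ} (hδψ : 0 ≤ δψ)
    (hsens : ρ * (querySensitivity τ δψ F * kappa δ ε) ≤ s) (i : Fin n) :
    IsDifferentiallyPrivate P F (FunnelAdj τ δψ) (funnelMechanism τ i Y) ε δ := by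
  intro ψ hψ ψ' hψ' hadj S hS
  have hYm : AEMeasurable Y P := AEMeasurable.of_map_ne_zero (by
    rw [hY]; exact IsProbabilityMeasure.ne_zero _)
  have hlaw : ∀ χ : ℝ≥0 → ℝ, P.real {ω | funnelMechanism τ i Y χ ω ∈ S} =
      (gaussianReal (m + χ (τ i)) (s ^ 2).toNNReal).real S := fun χ => by
    have h : HasLaw (funnelMechanism τ i Y χ) _ P :=
      gaussianReal_const_add (⟨hYm, hY⟩ : HasLaw Y _ P) (χ (τ i))
    rw [← h.map_eq, map_measureReal_apply_of_aemeasurable h.aemeasurable hS]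
    rfl
  rw [hlaw, hlaw]
  -- The profile is evaluated at s divided by the shift, so coinciding outputs are treated apart,
  -- using e^ε ≥ 1.
  by_cases hd : ψ (τ i) = ψ' (τ i)
  · rw [hd]
    have h1 : 1 ≤ Real.exp ε := Real.one_le_exp hε.le
    have h2 : 0 ≤ (gaussianReal (m + ψ' (τ i)) (s ^ 2).toNNReal).real S := measureReal_nonneg
    nlinarith
  · have hab : m + ψ (τ i) ≠ m + ψ' (τ i) := fun h => hd (add_left_cancel h)
    refine (gaussianReal_shift_le hab hs ε (Real.coe_toNNReal _ (sq_nonneg s)) hS).trans ?_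
    rw [add_sub_add_left_eq_sub]
    refine add_le_add_right (hprofile _ ?_) _
    rw [le_div_iff₀ (abs_pos.2 (sub_ne_zero.2 hd))]
    have h1 := abs_sub_le_querySensitivity hδψ hψ hψ' hadj i
    have h2 := mul_le_mul_of_nonneg_left h1 (mul_nonneg hρ (kappa_pos δ hε).le)
    linarith

end FunnelPrivacy

/-! ### Closeness to the steady state after `steadyStateTime`. -/

section SteadyState

lemma exp_le_of_steadyStateTime_le {ϑ θ T : ℝ} (hϑ : 0 < ϑ) (hθ : 0 < θ)
    (hT : steadyStateTime ϑ θ ≤ T) : Real.exp (-ϑ * T) ^ 2 ≤ θ := by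
  rw [steadyStateTime, div_le_iff₀ (by positivity), one_div, Real.log_inv] at hT
  rw [← Real.exp_nat_mul, ← Real.le_log_iff_exp_le hθ]
  push_cast
  linarith

/-- The deviation s is fixed before y₀ and the probability space, which makes the privacy threshold
uniform in them. -/
lemma IsOUTypeProcess.exists_gaussian_near_steadyState {ϑ σ ρ : ℝ} (hϑ : 0 < ϑ) (hσ : 0 < σ)
    (hρ : 0 < ρ) (hρ1 : ρ < 1) :
    ∃ K > 0, ∃ θ₀ > 0, ∀ θ : ℝ, 0 < θ → θ < θ₀ → ∀ T : ℝ≥0, steadyStateTime ϑ θ ≤ T →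
      ∃ s : ℝ, ρ * steadyStateStd ϑ σ ≤ s ∧ |s ^ 2 - steadyStateStd ϑ σ ^ 2| ≤ K * θ ∧
        Real.exp (-T / θ) ≤ θ ∧
        ∀ (y₀ : ℝ) (Ω : Type*) [MeasurableSpace Ω] (P : Measure Ω) (q w y : ℝ≥0 → Ω → ℝ),
          IsOUTypeProcess P θ ϑ σ y₀ q w y →
            P.map (y T) = gaussianReal (Real.exp (-T / θ) * y₀) (s ^ 2).toNNReal := by
  have hs₀ := steadyStateStd_pos hϑ hσ
  have hρ2 : 0 < 1 - ρ ^ 2 := by nlinarith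
  have hK : 0 < σ ^ 2 * (2 / ϑ + 14) := by positivity
  -- The first threshold gives ϑθ ≤ 1/2; the second makes the variance error at most (1 - ρ²) σ'²,
  -- so that s ≥ ρσ'.
  refine ⟨σ ^ 2 * (2 / ϑ + 14), hK, min (1 / (2 * ϑ))
    ((1 - ρ ^ 2) * steadyStateStd ϑ σ ^ 2 / (σ ^ 2 * (2 / ϑ + 14))),
    lt_min (by positivity) (by positivity), fun θ hθ hθlt T hT => ?_⟩
  have h1 : ϑ * θ ≤ 1 / 2 := by
    have := (hθlt.trans_le (min_le_left _ _)).le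
    rw [le_div_iff₀ (by positivity)] at this
    linarith
  have h2 : σ ^ 2 * (2 / ϑ + 14) * θ ≤ (1 - ρ ^ 2) * steadyStateStd ϑ σ ^ 2 := by
    have := (hθlt.trans_le (min_le_right _ _)).le
    rw [le_div_iff₀ hK] at this
    linarith
  have hexp := exp_le_of_steadyStateTime_le hϑ hθ hT
  set V : ℝ := σ ^ 2 * ∫ u in (0 : ℝ)..T, filterKernel θ ϑ u ^ 2 with hV
  have hVle : |V - steadyStateStd ϑ σ ^ 2| ≤ σ ^ 2 * (2 / ϑ + 14) * θ := by
    rw [steadyStateStd_sq hϑ, hV, ← mul_sub, abs_mul, abs_of_nonneg (sq_nonneg σ), mul_assoc]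
    exact mul_le_mul_of_nonneg_left
      (abs_integral_filterKernel_sq_sub_le hθ hϑ T.coe_nonneg h1 hexp) (sq_nonneg σ)
  have hVge : (ρ * steadyStateStd ϑ σ) ^ 2 ≤ V := by
    have := (abs_le.1 (hVle.trans h2)).1
    rw [mul_pow]
    linarith
  have hV0 : 0 ≤ V := (sq_nonneg _).trans hVge
  refine ⟨√V, Real.le_sqrt_of_sq_le hVge, ?_, le_trans ?_ hexp, ?_⟩
  · rwa [Real.sq_sqrt hV0]
  -- Since 2ϑ ≤ 1/θ, the fast transient e^{-T/θ} is dominated by e^{-2ϑT}.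
  · rw [← Real.exp_nat_mul, Real.exp_le_exp, div_le_iff₀ hθ]
    push_cast
    nlinarith [mul_le_mul_of_nonneg_left h1 T.coe_nonneg]
  · intro y₀ Ω _ P q w y h
    rw [Real.sq_sqrt hV0]
    exact h.map_eq_gaussianReal hθ.ne' (by linarith) T

lemma continuous_gaussianPDFReal (m : ℝ) (v : ℝ≥0) : Continuous (gaussianPDFReal m v) := by
  unfold gaussianPDFReal
  fun_prop

end SteadyState

theorem lemma1 (ϑ σG : ℝ) (hϑ : 0 < ϑ) (hσG : 0 < σG) :
    -- The density of `y(t)` is the steady-state density up to `O(θ)`, for `t ≥ T_ss`.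
    (∀ y₀ : ℝ, ∃ C > 0, ∃ θ₀ > 0, ∀ θ : ℝ, 0 < θ → θ < θ₀ →
      ∀ (Ω : Type*) [MeasurableSpace Ω] (P : Measure Ω) (q w y : ℝ≥0 → Ω → ℝ),
        IsOUTypeProcess P θ ϑ σG y₀ q w y →
        ∀ t : ℝ≥0, steadyStateTime ϑ θ ≤ t →
          ∃ p : ℝ → ℝ, Continuous p ∧ (∀ x, 0 ≤ p x) ∧
            P.map (y t) = volume.withDensity (fun x => ENNReal.ofReal (p x)) ∧
            ∀ x, |p x - steadyStatePdf ϑ σG x| ≤ C * θ) ∧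
    (∀ ε δ : ℝ, 0 < ε → 0 < δ → δ < 1 / 2 →
      -- Privacy of the mechanism when its noise has the steady-state density.
      (∀ (Ω : Type*) [MeasurableSpace Ω] (P : Measure Ω) (Y : Ω → ℝ),
        P.map Y = volume.withDensity (fun x => ENNReal.ofReal (steadyStatePdf ϑ σG x)) →
        ∀ (n : ℕ) (τ : Fin n → ℝ≥0) (F : Set (ℝ≥0 → ℝ)) (δψ : ℝ),
          (∀ ψ ∈ F, IsFunnelBoundary ψ) → 0 < δψ →
          querySensitivity τ δψ F * kappa δ ε ≤ steadyStateStd ϑ σG →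
          ∀ i, IsDifferentiallyPrivate P F (FunnelAdj τ δψ) (funnelMechanism τ i Y) ε δ) ∧
      -- Privacy of the mechanism with the noise `y(t)` itself, for small `θ` and `t ≥ T_ss`.
      (∃ θ₀ > 0, ∀ θ : ℝ, 0 < θ → θ < θ₀ →
        ∀ (y₀ : ℝ) (Ω : Type*) [MeasurableSpace Ω] (P : Measure Ω) (q w y : ℝ≥0 → Ω → ℝ),
          IsOUTypeProcess P θ ϑ σG y₀ q w y →
          ∀ (n : ℕ) (τ : Fin n → ℝ≥0) (F : Set (ℝ≥0 → ℝ)) (δψ : ℝ),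
            (∀ ψ ∈ F, IsFunnelBoundary ψ) → 0 < δψ →
            querySensitivity τ δψ F * kappa δ ε ≤ steadyStateStd ϑ σG →
            ∀ i, steadyStateTime ϑ θ ≤ τ i →
              IsDifferentiallyPrivate P F (FunnelAdj τ δψ)
                (funnelMechanism τ i (y (τ i))) ε δ)) := by
  have hs₀ := steadyStateStd_pos hϑ hσG
  have hne : ∀ s : ℝ, 0 < s → (s ^ 2).toNNReal ≠ 0 := fun s hs =>
    (Real.toNNReal_pos.2 (by positivity)).ne'
  refine ⟨fun y₀ => ?_, fun ε δ hε hδ hδ' => ⟨?_, ?_⟩⟩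
  · obtain ⟨K, hK, θ₀, hθ₀, h⟩ := IsOUTypeProcess.exists_gaussian_near_steadyState hϑ hσG
      (ρ := 1 / 2) (by norm_num) (by norm_num)
    refine ⟨8 / steadyStateStd ϑ σG ^ 2 * |y₀| + 4 / steadyStateStd ϑ σG ^ 3 * K, by positivity,
      θ₀, hθ₀, fun θ hθ hθlt Ω _ P q w y hy t ht => ?_⟩
    obtain ⟨s, hs, hs2, hexp, hlaw⟩ := h θ hθ hθlt t ht
    have hspos : 0 < s := by linarith
    refine ⟨gaussianPDFReal (Real.exp (-t / θ) * y₀) (s ^ 2).toNNReal,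
      continuous_gaussianPDFReal _ _, gaussianPDFReal_nonneg _ _, ?_, fun x => ?_⟩
    · rw [hlaw y₀ Ω P q w y hy, gaussianReal_of_var_ne_zero _ (hne s hspos)]
      rfl
    · rw [steadyStatePdf_eq_gaussianPDFReal hϑ hσG]
      refine (abs_gaussianPDFReal_sub_le hs₀ (by linarith) x).trans ?_
      have hm : |Real.exp (-t / θ) * y₀| ≤ θ * |y₀| := by
        rw [abs_mul, abs_of_pos (Real.exp_pos _)]
        exact mul_le_mul_of_nonneg_right hexp (abs_nonneg _)
      calc _ ≤ 8 / steadyStateStd ϑ σG ^ 2 * (θ * |y₀|) +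
            4 / steadyStateStd ϑ σG ^ 3 * (K * θ) := by gcongr
        _ = _ := by ring
  · intro Ω _ P Y hY n τ F δψ _ hδψ hsens i
    refine isDifferentiallyPrivate_funnelMechanism (m := 0) (ρ := 1) hs₀ ?_ hε hδ zero_le_one
      (fun r hr => gaussianPrivacyProfile_le hε hδ (by linarith) (by rwa [one_mul] at hr))
      hδψ.le (by rwa [one_mul]) i
    rw [hY, gaussianReal_of_var_ne_zero _ (hne _ hs₀)]
    simp only [steadyStatePdf_eq_gaussianPDFReal hϑ hσG]
    rfl
  -- The same ρ measures the slack in κ and the permitted loss of standard deviation.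
  · obtain ⟨ρ, hρ, hρ1, hprofile⟩ :=
      exists_lt_one_gaussianPrivacyProfile_le hε hδ (show δ < 1 by linarith)
    obtain ⟨K, -, θ₀, hθ₀, h⟩ :=
      IsOUTypeProcess.exists_gaussian_near_steadyState hϑ hσG hρ hρ1
    refine ⟨θ₀, hθ₀, fun θ hθ hθlt y₀ Ω _ P q w y hy n τ F δψ _ hδψ hsens i hi => ?_⟩
    obtain ⟨s, hs, -, -, hlaw⟩ := h θ hθ hθlt (τ i) hi
    exact isDifferentiallyPrivate_funnelMechanism (lt_of_lt_of_le (by positivity) hs)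
      (hlaw y₀ Ω P q w y hy) hε hδ hρ.le hprofile hδψ.le
      ((mul_le_mul_of_nonneg_left hsens hρ.le).trans hs) i
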